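/- Let $\epsilon>0$, $d>1$ be real numbers, $\epsilon_0=\min\{\epsilon,1/100\}$, $\alpha=\epsilon_0/2$, $\gamma=\epsilon_0^2$, $c=10$. Let $G=(V,E)$ be a finite graph with $n=|V|$ vertices and write $\Delta(v)$ for the degree of $v$. Give every vertex the weight $W(v)=(1+\gamma)^{-1}$ if $\Delta(v)\le(1+\alpha)d$, and $W(v)=d^{c}\Delta(v)$ otherwise (such a $v$ is called a high degree vertex). The weight of a path is the product of the weights of its vertices (both end points included). A vertex $v$ is a break-point if every path with at most $\frac{\ln n}{d^{2/5}}$ edges starting from $v$ has weight at most $1$. An influence path is a path (possibly a single vertex) that contains no break-point. The set $\mathcal B$ of blocks consists of: (1) for each cycle $C$ of length at most $4\frac{\ln n}{\ln^5 d}$, the vertices of $C$ together with all vertices reachable from a vertex of $C$ through an influence path; (2) for each vertex $v$ in no block of type (1), the block $\{v\}$ if $v$ is a break-point, and otherwise the set of all vertices reachable from $v$ through an influence path. Let $\mathcal G^B_d$ be the family of graphs for which $\mathcal B$ is a partition of $V$ and (A) each block induces a tree or a unicyclic graph; (B) for each $B\in\mathcal B$, each vertex $u\notin B$ adjacent to a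 vertex of $B$, and each high degree vertex $u'\in B$, no path of $G$ from $u$ to $u'$ has weight greater than $1$. Let $\lambda>0$ and let $\mathcal M_{hc}$ be the Markov chain on the independent sets of $G$ whose step from $X$ picks a block $B\in\mathcal B$ uniformly at random, keeps the configuration outside $B$, and draws the configuration on $B$ from the hard-core Gibbs distribution $\mu(\sigma)\propto\lambda^{|\sigma|}$ conditional on the configuration outside $B$. Let $P_X$ be the distribution of the state after one step from $X$, and let $H$ be the Hamming distance (the number of vertices at which two independent sets differ). Theorem. Suppose that $G\in\mathcal G^B_d$ and $0<\lambda\le\frac{1-\epsilon}{2d}$. Then for any two independent sets $X,Y$ of $G$ with $H(X,Y)=1$ there is a coupling $\nu_{X,Y}$ of $P_X$ and $P_Y$ such that, for $(X',Y')$ distributed as $\nu_{X,Y}$, $$E_{\nu_{X,Y}}[H(X',Y')]\le 1-\frac{\epsilon_0-20\epsilon_0^2}{n}.$$ -/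

import Mathlib

/-! ## Weights, break-points and blocks -/

section Blocks

variable {V : Type*} [Fintype V] (G : SimpleGraph V) [DecidableRel G.Adj]

/-- The weight `W(v)` of a vertex: `(1+γ)⁻¹` if `deg v ≤ (1+α)d`, and `d^c · deg v` otherwise. -/
noncomputable def vertexWeight (d α γ c : ℝ) (v : V) : ℝ :=
  if (G.degree v : ℝ) ≤ (1 + α) * d then (1 + γ)⁻¹ else d ^ c * (G.degree v : ℝ)

variable {G} in
/-- The weight of a path (or walk): the product of the weights of all its vertices, both end
points included. -/
noncomputable def pathWeight (d α γ c : ℝ) {u v : V} (p : G.Walk u v) : ℝ :=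
  (p.support.map (vertexWeight G d α γ c)).prod

/-- The weights of the paths with at most `ln n / d^(2/5)` edges which start from `v`. -/
def influenceWeights (d α γ c : ℝ) (v : V) : Set ℝ :=
  {x | ∃ (u : V) (p : G.Walk v u), p.IsPath ∧
    (p.length : ℝ) ≤ Real.log (Fintype.card V) / d ^ (2 / 5 : ℝ) ∧ x = pathWeight d α γ c p}

/-- The influence `E(v)`: the maximum weight of a path with at most `ln n / d^(2/5)` edges
which starts from `v` (it is a maximum: see `isGreatest_influence`). -/
noncomputable def influence (d α γ c : ℝ) (v : V) : ℝ :=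
  sSup (influenceWeights G d α γ c v)

theorem isGreatest_influence {d : ℝ} (hd : 0 ≤ d) (α γ c : ℝ) (v : V) :
    IsGreatest (influenceWeights G d α γ c v) (influence G d α γ c v) := by
  classical
  have hne : (influenceWeights G d α γ c v).Nonempty := by
    refine ⟨_, v, SimpleGraph.Walk.nil, SimpleGraph.Walk.IsPath.nil, ?_, rfl⟩
    simp only [SimpleGraph.Walk.length_nil, Nat.cast_zero]
    exact div_nonneg (Real.log_natCast_nonneg _) (Real.rpow_nonneg hd _)
  have hfin : (influenceWeights G d α γ c v).Finite := by
    refine (Set.finite_range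
      (fun q : (Σ u : V, G.Path v u) => pathWeight d α γ c (q.2 : G.Walk v q.1))).subset ?_
    rintro x ⟨u, p, hp, -, rfl⟩
    exact ⟨⟨u, ⟨p, hp⟩⟩, rfl⟩
  exact ⟨hne.csSup_mem hfin, fun x hx => le_csSup hfin.bddAbove hx⟩

/-- `v` is a break-point if its influence is at most `1`. -/
def IsBreakPoint (d α γ c : ℝ) (v : V) : Prop :=
  influence G d α γ c v ≤ 1

/-- `u` is reachable from `v` through an influence path, i.e. through a path which contains no
break-point. -/
def InfluenceReachable (d α γ c : ℝ) (v u : V) : Prop :=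
  ∃ p : G.Walk v u, p.IsPath ∧ ∀ x ∈ p.support, ¬ IsBreakPoint G d α γ c x

open Classical in
/-- The blocks of the first kind: for each cycle of length at most `4 ln n / ln⁵ d`, the vertices
of the cycle together with everything reachable from one of them through an influence path. -/
noncomputable def cycleBlocks (d α γ c : ℝ) : Finset (Finset V) :=
  Finset.univ.filter fun B => ∃ (v : V) (C : G.Walk v v), C.IsCycle ∧
    (C.length : ℝ) ≤ 4 * (Real.log (Fintype.card V) / Real.log d ^ 5) ∧
    ∀ u, u ∈ B ↔ u ∈ C.support ∨ ∃ x ∈ C.support, InfluenceReachable G d α γ c x u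

open Classical in
/-- The blocks of the second kind: every vertex `v` in no block of the first kind gives the block
`{v}` if it is a break-point, and otherwise the block of all the vertices that are reachable from
`v` through an influence path. -/
noncomputable def vertexBlocks (d α γ c : ℝ) : Finset (Finset V) :=
  Finset.univ.filter fun B => ∃ v : V, (∀ C ∈ cycleBlocks G d α γ c, v ∉ C) ∧
    ((IsBreakPoint G d α γ c v ∧ B = {v}) ∨
      (¬ IsBreakPoint G d α γ c v ∧ ∀ u, u ∈ B ↔ InfluenceReachable G d α γ c v u))

open Classical in
/-- The set of blocks `𝓑(α, γ, c)`. -/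
noncomputable def blocks (d α γ c : ℝ) : Finset (Finset V) :=
  cycleBlocks G d α γ c ∪ vertexBlocks G d α γ c

/-- A unicyclic graph: connected, with as many edges as vertices (a tree with one extra edge). -/
def IsUnicyclic {U : Type*} (H : SimpleGraph U) : Prop :=
  H.Connected ∧ Nat.card H.edgeSet = Nat.card U

/-- `u` is in the outer boundary of `B`. -/
def InOuterBoundary (B : Finset V) (u : V) : Prop :=
  u ∉ B ∧ ∃ v ∈ B, G.Adj u v

/-- The class `𝒢^B_d`, for the parameters `α = ε₀/2`, `γ = ε₀²`, `c = 10`. -/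
structure InClassGB (d ε₀ : ℝ) : Prop where
  /-- The blocks are a partition of the vertex set (they are non-empty and cover it by
  construction). -/
  disjoint : ∀ B₁ ∈ blocks G d (ε₀ / 2) (ε₀ ^ 2) 10, ∀ B₂ ∈ blocks G d (ε₀ / 2) (ε₀ ^ 2) 10,
    B₁ ≠ B₂ → Disjoint B₁ B₂
  /-- (A) Every block induces a tree or a unicyclic graph. -/
  tree_or_unicyclic : ∀ B ∈ blocks G d (ε₀ / 2) (ε₀ ^ 2) 10,
    (G.induce (B : Set V)).IsTree ∨ IsUnicyclic (G.induce (B : Set V))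
  /-- (B) No path from the outer boundary of a block to a high degree vertex of the block has
  weight greater than `1`. -/
  no_heavy_path : ∀ B ∈ blocks G d (ε₀ / 2) (ε₀ ^ 2) 10,
    ∀ u, InOuterBoundary G B u → ∀ u' ∈ B, (1 + ε₀ / 2) * d < (G.degree u' : ℝ) →
      ¬ ∃ L : G.Walk u u', L.IsPath ∧ 1 < pathWeight d (ε₀ / 2) (ε₀ ^ 2) 10 L

end Blocks

/-! ## The hard-core model and its block dynamics -/

section HardCore

variable {V : Type*} [Fintype V] [DecidableEq V] (G : SimpleGraph V)

/-- The states of the hard-core model: the independent sets of `G`. -/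
abbrev IndepState : Type _ := {σ : Finset V // G.IsIndepSet (σ : Set V)}

noncomputable instance : Fintype (IndepState G) := Fintype.ofFinite _

/-- The partition function `Z`. -/
noncomputable def partitionFunction (lam : ℝ) : ℝ :=
  ∑ σ : IndepState G, lam ^ σ.1.card

/-- The Gibbs distribution of the hard-core model with fugacity `lam`. -/
noncomputable def gibbs (lam : ℝ) (σ : IndepState G) : ℝ :=
  lam ^ σ.1.card / partitionFunction G lam

variable {G}

/-- `σ` and `τ` agree at every vertex outside `B`. -/
def AgreeOff (B : Finset V) (σ τ : IndepState G) : Prop :=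
  ∀ v, v ∉ B → (v ∈ σ.1 ↔ v ∈ τ.1)

/-- The Hamming distance: the number of vertices at which `σ` and `τ` differ. -/
def hamming (σ τ : IndepState G) : ℕ := (symmDiff σ.1 τ.1).card

open Classical in
/-- The update of the block `B` from the state `X`: the Gibbs distribution conditional on the
configuration outside `B` being that of `X`. -/
noncomputable def blockUpdate (lam : ℝ) (B : Finset V) (X X' : IndepState G) : ℝ :=
  if AgreeOff B X X' then
    gibbs G lam X' / ∑ σ ∈ Finset.univ.filter (fun σ => AgreeOff B X σ), gibbs G lam σ
  else 0

/-- One step of the block dynamics with set of blocks `𝓑`: choose a block uniformly at random and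
update it. `blockStep lam 𝓑 X X'` is the probability of moving from `X` to `X'`. -/
noncomputable def blockStep (lam : ℝ) (𝓑 : Finset (Finset V)) (X X' : IndepState G) : ℝ :=
  ∑ B ∈ 𝓑, (1 / (𝓑.card : ℝ)) * blockUpdate lam B X X'

/-- `ν` is a coupling of the distributions `P` and `Q` on a finite set. -/
structure IsCoupling {S : Type*} [Fintype S] (P Q : S → ℝ) (ν : S → S → ℝ) : Prop where
  nonneg : ∀ x y, 0 ≤ ν x y
  marginal_fst : ∀ x, ∑ y, ν x y = P x
  marginal_snd : ∀ y, ∑ x, ν x y = Q y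

end HardCore

/-! Let `w` be the only disagreement, occupied in `X` and vacant in `Y`. Both chains update the same
random block `B`. If `w ∈ B`, the two conditional distributions coincide and the disagreement
disappears. Otherwise `w` survives, and each neighbour of `w` in `B` is blocked in one chain only.

The cost of blocking an available vertex `z` obeys a recursion. The two distributions differ only
through the event that `z` is occupied, whose probability is at most `lam`. On that event the cost
is one for `z` itself, plus that of blocking its available neighbours one after another
(`transport_condGibbs_erase`). Each vertex met is removed from the available set, so the recursion
explores self-avoiding paths from `w`.

The vertex weights make the recursion close up: `lam * deg z ≤ ρ * W z` with `ρ` slightly below 1/2.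
A path `Q` from `w` to the vertex just before `z` gives the bound `lam / ((1 - ρ) * weight Q)` for
blocking `z` (`transport_condGibbs_erase_of_path`). The induction needs `weight Q ≤ 1`. Low degree
vertices never increase the weight, and at high degree vertices condition (B) supplies the bound.

A high degree `w` has no neighbour outside its own block (`InClassGB.not_inOuterBoundary`). A low
degree `w` has at most `(1 + α) d` neighbours, so the new disagreements, summed over all blocks,
cost at most `ρ / (1 - ρ)`, which is about `1 - ε₀`. The block of `w` gains 1, and there are at most
`n` blocks (`transport_blockStep`). -/

/-! ## Couplings of bounded cost -/

section Transport

variable {S : Type*} [Fintype S]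

/-- `P` and `Q` have a coupling whose expected cost is at most `t`. -/
def TransportLE (c : S → S → ℝ) (P Q : S → ℝ) (t : ℝ) : Prop :=
  ∃ ν : S → S → ℝ, IsCoupling P Q ν ∧ ∑ x, ∑ y, ν x y * c x y ≤ t

namespace TransportLE

variable {c : S → S → ℝ} {P Q R : S → ℝ} {s t : ℝ}

theorem mono (h : TransportLE c P Q s) (hst : s ≤ t) : TransportLE c P Q t := by
  obtain ⟨ν, h1, h2⟩ := h
  exact ⟨ν, h1, h2.trans hst⟩

theorem sum_eq (h : TransportLE c P Q t) : ∑ x, P x = ∑ x, Q x := by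
  obtain ⟨ν, h1, -⟩ := h
  simp_rw [← h1.marginal_fst, ← h1.marginal_snd]
  exact Finset.sum_comm

theorem symm (hc : ∀ x y, c x y = c y x) (h : TransportLE c P Q t) : TransportLE c Q P t := by
  obtain ⟨ν, h1, h2⟩ := h
  refine ⟨fun x y => ν y x, ⟨fun x y => h1.nonneg y x, h1.marginal_snd, h1.marginal_fst⟩, ?_⟩
  rw [Finset.sum_comm]
  simpa only [hc] using h2

/-- The coupling of `P` with its image under `f`. -/
theorem of_map [DecidableEq S] (f : S → S) (hP : ∀ x, 0 ≤ P x)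
    (hQ : ∀ y, ∑ x, (if f x = y then P x else 0) = Q y) (ht : ∑ x, P x * c x (f x) ≤ t) :
    TransportLE c P Q t := by
  refine ⟨fun x y => if f x = y then P x else 0, ⟨fun x y => ?_, fun x => ?_, hQ⟩, ?_⟩
  · split_ifs
    exacts [hP x, le_rfl]
  · simp
  · simpa [ite_mul] using ht

theorem refl (hc : ∀ x, c x x = 0) (hP : ∀ x, 0 ≤ P x) : TransportLE c P P 0 := by
  classical
  exact of_map id hP (by simp) (by simp [hc])

theorem smul {a : ℝ} (ha : 0 ≤ a) (h : TransportLE c P Q t) :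
    TransportLE c (fun x => a * P x) (fun x => a * Q x) (a * t) := by
  obtain ⟨ν, h1, h2⟩ := h
  refine ⟨fun x y => a * ν x y, ⟨fun x y => mul_nonneg ha (h1.nonneg x y), fun x => ?_,
    fun y => ?_⟩, ?_⟩
  · rw [← Finset.mul_sum, h1.marginal_fst]
  · rw [← Finset.mul_sum, h1.marginal_snd]
  · simp_rw [mul_assoc, ← Finset.mul_sum]
    exact mul_le_mul_of_nonneg_left h2 ha

theorem add {P' Q' : S → ℝ} (h : TransportLE c P Q s) (h' : TransportLE c P' Q' t) :
    TransportLE c (fun x => P x + P' x) (fun x => Q x + Q' x) (s + t) := by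
  obtain ⟨ν, h1, h2⟩ := h
  obtain ⟨ν', h1', h2'⟩ := h'
  refine ⟨fun x y => ν x y + ν' x y, ⟨fun x y => add_nonneg (h1.nonneg x y) (h1'.nonneg x y),
    fun x => ?_, fun y => ?_⟩, ?_⟩
  · rw [Finset.sum_add_distrib, h1.marginal_fst, h1'.marginal_fst]
  · rw [Finset.sum_add_distrib, h1.marginal_snd, h1'.marginal_snd]
  · simp_rw [add_mul, Finset.sum_add_distrib]
    exact add_le_add h2 h2'

theorem sum {ι : Type*} (I : Finset ι) {P Q : ι → S → ℝ} {t : ι → ℝ}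
    (h : ∀ i ∈ I, TransportLE c (P i) (Q i) (t i)) :
    TransportLE c (fun x => ∑ i ∈ I, P i x) (fun x => ∑ i ∈ I, Q i x) (∑ i ∈ I, t i) := by
  classical
  induction I using Finset.induction_on with
  | empty => exact ⟨fun _ _ => 0, ⟨by simp, by simp, by simp⟩, by simp⟩
  | insert i I hi ih =>
    simp_rw [Finset.sum_insert hi]
    exact (h i (Finset.mem_insert_self i I)).add
      (ih fun j hj => h j (Finset.mem_insert_of_mem hj))

/-- Gluing of couplings. -/
theorem trans (hc : ∀ x y z, c x z ≤ c x y + c y z) (h : TransportLE c P Q s)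
    (h' : TransportLE c Q R t) : TransportLE c P R (s + t) := by
  obtain ⟨ν, h1, h2⟩ := h
  obtain ⟨ν', h1', h2'⟩ := h'
  have hQ : ∀ y, 0 ≤ Q y := fun y => by
    rw [← h1.marginal_snd]; exact Finset.sum_nonneg fun x _ => h1.nonneg x y
  -- The glued coupling divides by `Q y`. Where `Q y = 0` the quotient is 0 by convention, and no
  -- mass is lost because both couplings vanish there.
  have hν : ∀ x y, Q y = 0 → ν x y = 0 := fun x y hy =>
    (Finset.sum_eq_zero_iff_of_nonneg fun x _ => h1.nonneg x y).1
      ((h1.marginal_snd y).trans hy) x (Finset.mem_univ x)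
  have hν' : ∀ y z, Q y = 0 → ν' y z = 0 := fun y z hy =>
    (Finset.sum_eq_zero_iff_of_nonneg fun z _ => h1'.nonneg y z).1
      ((h1'.marginal_fst y).trans hy) z (Finset.mem_univ z)
  have e1 : ∀ x y, ∑ z, ν x y * ν' y z / Q y = ν x y := fun x y => by
    rw [← Finset.sum_div, ← Finset.mul_sum, h1'.marginal_fst]
    by_cases hy : Q y = 0
    · simp [hν x y hy]
    · field_simp
  have e2 : ∀ y z, ∑ x, ν x y * ν' y z / Q y = ν' y z := fun y z => by
    rw [← Finset.sum_div, ← Finset.sum_mul, h1.marginal_snd]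
    by_cases hy : Q y = 0
    · simp [hν' y z hy]
    · field_simp
  have hpos : ∀ x y z, 0 ≤ ν x y * ν' y z / Q y := fun x y z =>
    div_nonneg (mul_nonneg (h1.nonneg x y) (h1'.nonneg y z)) (hQ y)
  refine ⟨fun x z => ∑ y, ν x y * ν' y z / Q y, ⟨fun x z => Finset.sum_nonneg fun y _ =>
    hpos x y z, fun x => ?_, fun z => ?_⟩, ?_⟩
  · rw [Finset.sum_comm]
    simp_rw [e1, h1.marginal_fst]
  · rw [Finset.sum_comm]
    simp_rw [e2, h1'.marginal_snd]
  · have a1 : ∑ x, ∑ z, ∑ y, ν x y * ν' y z / Q y * c x y = ∑ x, ∑ y, ν x y * c x y := by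
      refine Finset.sum_congr rfl fun x _ => ?_
      rw [Finset.sum_comm]
      simp_rw [← Finset.sum_mul, e1]
    have a2 : ∑ x, ∑ z, ∑ y, ν x y * ν' y z / Q y * c y z = ∑ y, ∑ z, ν' y z * c y z := by
      calc _ = ∑ z, ∑ y, ∑ x, ν x y * ν' y z / Q y * c y z := by
            rw [Finset.sum_comm]
            exact Finset.sum_congr rfl fun z _ => Finset.sum_comm
        _ = _ := by
            simp_rw [← Finset.sum_mul, e2]
            exact Finset.sum_comm
    calc _ ≤ ∑ x, ∑ z, ∑ y, (ν x y * ν' y z / Q y * c x y + ν x y * ν' y z / Q y * c y z) := by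
          refine Finset.sum_le_sum fun x _ => Finset.sum_le_sum fun z _ => ?_
          rw [Finset.sum_mul]
          refine Finset.sum_le_sum fun y _ => ?_
          rw [← mul_add]
          exact mul_le_mul_of_nonneg_left (hc x y z) (hpos x y z)
      _ = ∑ x, ∑ y, ν x y * c x y + ∑ y, ∑ z, ν' y z * c y z := by
          simp_rw [Finset.sum_add_distrib]
          rw [a1, a2]
      _ ≤ s + t := add_le_add h2 h2'

end TransportLE

end Transport

/-! ## Hard-core measures with prescribed occupied and available vertices -/

section CondGibbs

variable {V : Type*} [DecidableEq V] {G : SimpleGraph V} {lam : ℝ}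

theorem hamming_comm (σ τ : IndepState G) : hamming σ τ = hamming τ σ := by
  unfold hamming
  rw [symmDiff_comm]

theorem hamming_self (σ : IndepState G) : hamming σ σ = 0 := by
  simp [hamming]

theorem hamming_triangle (σ τ υ : IndepState G) :
    hamming σ υ ≤ hamming σ τ + hamming τ υ :=
  (Finset.card_le_card (symmDiff_triangle σ.1 τ.1 υ.1)).trans (Finset.card_union_le _ _)

/-- The Hamming distance as a real cost. -/
def hammingCost (σ τ : IndepState G) : ℝ := (hamming σ τ : ℝ)

/-- The unnormalised hard-core measure on the independent sets `σ` with `A ⊆ σ ⊆ A ∪ S`. -/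
noncomputable def condWeight (lam : ℝ) (A S : Finset V) (σ : IndepState G) : ℝ :=
  if A ⊆ σ.1 ∧ σ.1 ⊆ A ∪ S then lam ^ σ.1.card else 0

theorem condWeight_nonneg (hlam : 0 < lam) (A S : Finset V) (σ : IndepState G) :
    0 ≤ condWeight lam A S σ := by
  unfold condWeight
  split_ifs
  exacts [by positivity, le_rfl]

/-- Splitting according to the state of `z`. -/
theorem condWeight_split {A S : Finset V} {z : V} (hzS : z ∈ S) (hzA : z ∉ A)
    (σ : IndepState G) :
    condWeight lam A S σ
      = condWeight lam (insert z A) (S.erase z) σ + condWeight lam A (S.erase z) σ := by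
  unfold condWeight
  have hunion : insert z A ∪ S.erase z = A ∪ S := by
    ext x
    by_cases hx : x = z <;> simp [hx, hzS]
  by_cases hz : z ∈ σ.1
  · rw [if_neg (c := A ⊆ σ.1 ∧ σ.1 ⊆ A ∪ S.erase z) (fun h => by simpa [hzA] using h.2 hz), hunion,
      add_zero]
    simp [Finset.insert_subset_iff, hz]
  · rw [if_neg (c := insert z A ⊆ σ.1 ∧ _) (fun h => hz (h.1 (Finset.mem_insert_self z A))),
      zero_add]
    have : σ.1 ⊆ A ∪ S ↔ σ.1 ⊆ A ∪ S.erase z := by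
      refine forall₂_congr fun x hx => ?_
      have hxz : x ≠ z := fun h => hz (h ▸ hx)
      simp [hxz]
    simp only [this]

/-- The neighbours of an occupied vertex are not available. -/
theorem condWeight_insert_sdiff [DecidableRel G.Adj] (w : V) (A S : Finset V)
    (σ : IndepState G) :
    condWeight lam (insert w A) S σ
      = condWeight lam (insert w A) (S \ S.filter (G.Adj w)) σ := by
  unfold condWeight
  refine if_congr (and_congr_right fun h => forall₂_congr fun x hx => ?_) rfl rfl
  have hw : w ∈ σ.1 := h (Finset.mem_insert_self w A)
  have hxw : ¬ G.Adj w x := fun hadj =>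
    σ.2 (Finset.mem_coe.2 hw) (Finset.mem_coe.2 hx) hadj.ne hadj
  simp [hxw]

/-- Erasing the vertex `w` from a state. -/
def eraseState (w : V) (σ : IndepState G) : IndepState G :=
  ⟨σ.1.erase w, σ.2.mono (by simp)⟩

theorem hamming_eraseState {w : V} {σ : IndepState G} (hw : w ∈ σ.1) :
    hamming σ (eraseState w σ) = 1 := by
  have : symmDiff σ.1 (σ.1.erase w) = {w} := by
    ext x
    by_cases hx : x = w <;> simp [Finset.mem_symmDiff, hx, hw]
  simp [hamming, eraseState, this]

variable [Fintype V]

variable (G) in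
/-- The total mass of `condWeight`. -/
noncomputable def condPartition (lam : ℝ) (A S : Finset V) : ℝ :=
  ∑ σ : IndepState G, condWeight lam A S σ

/-- The hard-core distribution on the independent sets `σ` with `A ⊆ σ ⊆ A ∪ S`. -/
noncomputable def condGibbs (lam : ℝ) (A S : Finset V) (σ : IndepState G) : ℝ :=
  (condPartition G lam A S)⁻¹ * condWeight lam A S σ

theorem condPartition_nonneg (hlam : 0 < lam) (A S : Finset V) :
    0 ≤ condPartition G lam A S :=
  Finset.sum_nonneg fun σ _ => condWeight_nonneg hlam A S σ

theorem condGibbs_nonneg (hlam : 0 < lam) (A S : Finset V) (σ : IndepState G) :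
    0 ≤ condGibbs lam A S σ :=
  mul_nonneg (inv_nonneg.2 (condPartition_nonneg hlam A S)) (condWeight_nonneg hlam A S σ)

theorem condPartition_pos (hlam : 0 < lam) {A : Finset V} (hA : G.IsIndepSet (A : Set V))
    (S : Finset V) : 0 < condPartition G lam A S := by
  refine Finset.sum_pos' (fun σ _ => condWeight_nonneg hlam A S σ)
    ⟨⟨A, hA⟩, Finset.mem_univ _, ?_⟩
  rw [condWeight, if_pos ⟨subset_rfl, Finset.subset_union_left⟩]
  positivity

theorem condPartition_mono (hlam : 0 < lam) (A : Finset V) {S T : Finset V} (h : S ⊆ T) :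
    condPartition G lam A S ≤ condPartition G lam A T := by
  refine Finset.sum_le_sum fun σ _ => ?_
  unfold condWeight
  split_ifs with h1 h2
  · exact le_rfl
  · exact absurd ⟨h1.1, h1.2.trans (Finset.union_subset_union_right h)⟩ h2
  · positivity
  · exact le_rfl

/-- Occupying a vertex without available neighbours multiplies the measure by `lam`. -/
theorem sum_condWeight_insert {A S : Finset V} {w : V}
    (hA : G.IsIndepSet ((insert w A : Finset V) : Set V)) (hwA : w ∉ A) (hwS : w ∉ S)
    (hS : ∀ x ∈ S, ¬ G.Adj w x) (τ : IndepState G) :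
    ∑ σ, (if eraseState w σ = τ then condWeight lam (insert w A) S σ else 0)
      = lam * condWeight lam A S τ := by
  have hwAS : w ∉ A ∪ S := by simp [hwA, hwS]
  by_cases hτ : A ⊆ τ.1 ∧ τ.1 ⊆ A ∪ S
  · have hwτ : w ∉ τ.1 := fun h => hwAS (hτ.2 h)
    have hnadj : ∀ x ∈ τ.1, ¬ G.Adj w x := by
      intro x hx hadj
      rcases Finset.mem_union.1 (hτ.2 hx) with h | h
      · exact hA (by simp) (by simp [h]) hadj.ne hadj
      · exact hS x h hadj
    have hind : G.IsIndepSet ((insert w τ.1 : Finset V) : Set V) := by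
      rw [Finset.coe_insert]
      exact Set.pairwise_insert.2 ⟨τ.2, fun b hb _ =>
        ⟨hnadj b hb, fun h => hnadj b hb h.symm⟩⟩
    -- Among the states containing `w`, this is the only one that becomes `τ` when `w` is erased.
    rw [Finset.sum_eq_single (⟨insert w τ.1, hind⟩ : IndepState G)]
    · have h1 : eraseState w (⟨insert w τ.1, hind⟩ : IndepState G) = τ :=
        Subtype.ext (Finset.erase_insert hwτ)
      rw [if_pos h1, condWeight, condWeight, if_pos hτ, if_pos, Finset.card_insert_of_notMem hwτ,
        pow_succ']
      refine ⟨Finset.insert_subset_insert w hτ.1, ?_⟩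
      rw [Finset.insert_union]
      exact Finset.insert_subset_insert w hτ.2
    · intro σ _ hσ
      split_ifs with h
      · rw [condWeight, if_neg]
        rintro ⟨h1, -⟩
        refine hσ (Subtype.ext ?_)
        have : σ.1.erase w = τ.1 := congrArg Subtype.val h
        simp only [← this]
        exact (Finset.insert_erase (h1 (Finset.mem_insert_self w A))).symm
      · rfl
    · simp
  · rw [condWeight, if_neg hτ, mul_zero]
    refine Finset.sum_eq_zero fun σ _ => ?_
    split_ifs with h
    · rw [condWeight, if_neg]
      rintro ⟨h1, h2⟩
      refine hτ ?_
      rw [← h]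
      refine ⟨fun x hx => ?_, fun x hx => ?_⟩
      · exact Finset.mem_erase.2 ⟨fun e => hwA (e ▸ hx), h1 (Finset.mem_insert_of_mem hx)⟩
      · have hx' := Finset.mem_erase.1 hx
        have := h2 hx'.2
        rw [Finset.insert_union] at this
        exact Finset.mem_of_mem_insert_of_ne this hx'.1
    · rfl

/-- Erasing `w` moves every state of positive weight by Hamming distance exactly one, so the cost is
the total mass. -/
theorem transport_condWeight_insert (hlam : 0 < lam) {A S : Finset V} {w : V}
    (hA : G.IsIndepSet ((insert w A : Finset V) : Set V)) (hwA : w ∉ A) (hwS : w ∉ S)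
    (hS : ∀ x ∈ S, ¬ G.Adj w x) :
    TransportLE (hammingCost (G := G)) (condWeight lam (insert w A) S)
      (fun σ => lam * condWeight lam A S σ) (condPartition G lam (insert w A) S) := by
  refine TransportLE.of_map (eraseState w) (condWeight_nonneg hlam _ _)
    (sum_condWeight_insert hA hwA hwS hS) (Finset.sum_le_sum fun σ _ => ?_)
  by_cases hw : w ∈ σ.1
  · simp [hammingCost, hamming_eraseState hw]
  · rw [condWeight, if_neg fun h => hw (h.1 (Finset.mem_insert_self w A)), zero_mul]

/-- The block update is the hard-core distribution with the configuration outside prescribed. -/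
theorem blockUpdate_eq_condGibbs (hlam : 0 < lam) (B : Finset V) (X : IndepState G) :
    blockUpdate lam B X = condGibbs lam (X.1 \ B) B := by
  classical
  have hagree : ∀ σ : IndepState G,
      AgreeOff B X σ ↔ X.1 \ B ⊆ σ.1 ∧ σ.1 ⊆ X.1 \ B ∪ B := by
    intro σ
    constructor
    · intro h
      refine ⟨fun v hv => ?_, fun v hv => ?_⟩
      · have hv := Finset.mem_sdiff.1 hv
        exact (h v hv.2).1 hv.1
      · by_cases hvB : v ∈ B
        · simp [hvB]
        · simp [hvB, (h v hvB).2 hv]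
    · rintro ⟨h1, h2⟩ v hv
      refine ⟨fun h => h1 (Finset.mem_sdiff.2 ⟨h, hv⟩), fun h => ?_⟩
      simpa [hv] using h2 h
  have hZ : 0 < partitionFunction G lam := by
    refine Finset.sum_pos (fun σ _ => by positivity) ⟨X, Finset.mem_univ _⟩
  have hsum : ∑ σ ∈ Finset.univ.filter (fun σ => AgreeOff B X σ), gibbs G lam σ
      = condPartition G lam (X.1 \ B) B / partitionFunction G lam := by
    rw [Finset.sum_filter, condPartition, Finset.sum_div]
    refine Finset.sum_congr rfl fun σ _ => ?_
    rw [condWeight, gibbs]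
    simp only [hagree]
    split_ifs
    exacts [rfl, (zero_div _).symm]
  funext σ
  rw [blockUpdate, hsum, condGibbs, condWeight, gibbs]
  simp only [hagree]
  split_ifs
  · have hpos : 0 < condPartition G lam (X.1 \ B) B :=
      condPartition_pos hlam (X.2.mono (by simp)) B
    field_simp
  · simp

theorem condPartition_insert_sdiff [DecidableRel G.Adj] (w : V) (A S : Finset V) :
    condPartition G lam (insert w A) S
      = condPartition G lam (insert w A) (S \ S.filter (G.Adj w)) :=
  Finset.sum_congr rfl fun σ _ => condWeight_insert_sdiff w A S σ

/-- Coupled measures have equal total mass, so the identity is read off from the erasing coupling.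
-/
theorem condPartition_insert [DecidableRel G.Adj] (hlam : 0 < lam) {A S : Finset V} {w : V}
    (hA : G.IsIndepSet ((insert w A : Finset V) : Set V)) (hwA : w ∉ A) (hwS : w ∉ S) :
    condPartition G lam (insert w A) S
      = lam * condPartition G lam A (S \ S.filter (G.Adj w)) := by
  rw [condPartition_insert_sdiff, condPartition,
    (transport_condWeight_insert hlam hA hwA (S := S \ S.filter (G.Adj w)) (by simp [hwS])
      (by simp +contextual)).sum_eq, ← Finset.mul_sum, condPartition]

theorem condPartition_insert_le [DecidableRel G.Adj] (hlam : 0 < lam) {A S : Finset V} {w : V}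
    (hwA : w ∉ A) (hwS : w ∉ S) :
    condPartition G lam (insert w A) S ≤ lam * condPartition G lam A S := by
  by_cases hA : G.IsIndepSet ((insert w A : Finset V) : Set V)
  · rw [condPartition_insert hlam hA hwA hwS]
    exact mul_le_mul_of_nonneg_left (condPartition_mono hlam A Finset.sdiff_subset) hlam.le
  · have : condPartition G lam (insert w A) S = 0 := by
      refine Finset.sum_eq_zero fun σ _ => ?_
      rw [condWeight, if_neg]
      exact fun h => hA (σ.2.mono (by exact_mod_cast h.1))
    rw [this]
    exact mul_nonneg hlam.le (condPartition_nonneg hlam A S)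

/-- Telescoping: the vertices of `N` are removed one at a time and the couplings are glued by the
triangle inequality. The hypothesis covers all `T ⊆ S` because of the intermediate sets. -/
theorem transport_condGibbs_sdiff (hlam : 0 < lam) {A S N : Finset V} {t : ℝ} (hN : N ⊆ S)
    (h : ∀ z ∈ N, ∀ T ⊆ S, z ∈ T →
      TransportLE (hammingCost (G := G)) (condGibbs lam A T) (condGibbs lam A (T.erase z)) t) :
    TransportLE (hammingCost (G := G)) (condGibbs lam A S) (condGibbs lam A (S \ N))
      (N.card * t) := by
  induction N using Finset.induction_on with
  | empty =>
    simpa using TransportLE.refl (c := hammingCost (G := G)) (by simp [hammingCost, hamming_self])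
      (condGibbs_nonneg hlam A S)
  | insert z N hz ih =>
    have h1 := ih ((Finset.subset_insert z N).trans hN)
      fun y hy => h y (Finset.mem_insert_of_mem hy)
    have h2 := h z (Finset.mem_insert_self z N) (S \ N) Finset.sdiff_subset
      (Finset.mem_sdiff.2 ⟨hN (Finset.mem_insert_self z N), hz⟩)
    have h3 := h1.trans (fun σ τ υ => by
      simp only [hammingCost]; exact_mod_cast hamming_triangle σ τ υ) h2
    rw [Finset.sdiff_insert, Finset.card_insert_of_notMem hz]
    refine h3.mono (le_of_eq ?_)
    push_cast
    ring

/-- A disagreement at `w` costs one, plus the cost of removing its available neighbours. -/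
theorem transport_condGibbs_insert [DecidableRel G.Adj] (hlam : 0 < lam) {A S : Finset V} {w : V} {t : ℝ}
    (hA : G.IsIndepSet ((insert w A : Finset V) : Set V)) (hwA : w ∉ A) (hwS : w ∉ S)
    (h : ∀ z ∈ S, G.Adj w z → ∀ T ⊆ S, z ∈ T →
      TransportLE (hammingCost (G := G)) (condGibbs lam A T) (condGibbs lam A (T.erase z)) t) :
    TransportLE (hammingCost (G := G)) (condGibbs lam (insert w A) S) (condGibbs lam A S)
      (1 + (S.filter (G.Adj w)).card * t) := by
  have hA' : G.IsIndepSet (A : Set V) := hA.mono (by simp)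
  have hZ := condPartition_pos hlam hA S
  have hZ' := condPartition_pos hlam hA' (S \ S.filter (G.Adj w))
  -- Once the left side is normalised, the factor `lam` cancels on the right. What remains is the
  -- distribution without `w` in which the neighbours of `w` are unavailable.
  have h1 := (transport_condWeight_insert hlam hA hwA (S := S \ S.filter (G.Adj w))
    (by simp [hwS]) (by simp +contextual)).smul (inv_nonneg.2 hZ.le)
  rw [← condPartition_insert_sdiff, inv_mul_cancel₀ hZ.ne'] at h1
  have e1 : (fun σ : IndepState G => (condPartition G lam (insert w A) S)⁻¹
      * condWeight lam (insert w A) (S \ S.filter (G.Adj w)) σ) = condGibbs lam (insert w A) S := by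
    funext σ
    rw [condGibbs, ← condWeight_insert_sdiff]
  have e2 : (fun σ : IndepState G => (condPartition G lam (insert w A) S)⁻¹
      * (lam * condWeight lam A (S \ S.filter (G.Adj w)) σ))
      = condGibbs lam A (S \ S.filter (G.Adj w)) := by
    funext σ
    rw [condGibbs, condPartition_insert hlam hA hwA hwS]
    field_simp
  rw [e1, e2] at h1
  have hsymm : ∀ σ τ : IndepState G, hammingCost σ τ = hammingCost τ σ := fun σ τ => by
    rw [hammingCost, hammingCost, hamming_comm]
  exact h1.trans (fun σ τ υ => by
      simp only [hammingCost]; exact_mod_cast hamming_triangle σ τ υ)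
    ((transport_condGibbs_sdiff hlam (Finset.filter_subset _ _) fun z hz T hT hzT =>
      h z (Finset.mem_filter.1 hz).1 (Finset.mem_filter.1 hz).2 T hT hzT).symm hsymm)

/-- The cost of making one vertex unavailable. -/
theorem transport_condGibbs_erase [DecidableRel G.Adj] (hlam : 0 < lam) {A S : Finset V} {z : V} {t : ℝ}
    (hA : G.IsIndepSet (A : Set V)) (hzA : z ∉ A) (hzS : z ∈ S) (ht : 0 ≤ t)
    (h : ∀ y ∈ S.erase z, G.Adj z y → ∀ T ⊆ S.erase z, y ∈ T →
      TransportLE (hammingCost (G := G)) (condGibbs lam A T) (condGibbs lam A (T.erase y)) t) :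
    TransportLE (hammingCost (G := G)) (condGibbs lam A S) (condGibbs lam A (S.erase z))
      (lam * (1 + ((S.erase z).filter (G.Adj z)).card * t)) := by
  have hz' : z ∉ S.erase z := Finset.notMem_erase z S
  have hZ := condPartition_pos hlam hA S
  have hZ0 := condPartition_pos hlam hA (S.erase z)
  have hZsplit : condPartition G lam A S
      = condPartition G lam (insert z A) (S.erase z) + condPartition G lam A (S.erase z) := by
    simp only [condPartition, ← Finset.sum_add_distrib]
    exact Finset.sum_congr rfl fun σ _ => condWeight_split hzS hzA σ
  have hrefl := TransportLE.refl (c := hammingCost (G := G)) (by simp [hammingCost, hamming_self])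
    (condGibbs_nonneg hlam A (S.erase z))
  have hZ1 := condPartition_nonneg (G := G) hlam (insert z A) (S.erase z)
  set Z := condPartition G lam A S with hZdef
  set Z0 := condPartition G lam A (S.erase z) with hZ0def
  set Z1 := condPartition G lam (insert z A) (S.erase z) with hZ1def
  -- `Z1 / Z` is the probability that `z` is occupied.
  have hp : Z1 / Z ≤ lam := by
    rw [div_le_iff₀ hZ]
    exact (condPartition_insert_le hlam hzA hz').trans
      (mul_le_mul_of_nonneg_left (condPartition_mono hlam A (Finset.erase_subset z S)) hlam.le)
  have hone : Z1 / Z + Z0 / Z = 1 := by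
    rw [← add_div, ← hZsplit, div_self hZ.ne']
  by_cases hA1 : G.IsIndepSet ((insert z A : Finset V) : Set V)
  · have hZ1pos : 0 < Z1 := condPartition_pos hlam hA1 _
    -- Mixture over the state of `z`: the vacant part is coupled identically at no cost, and only
    -- the occupied part pays.
    have h1 := ((transport_condGibbs_insert hlam hA1 hzA hz' h).smul
      (div_nonneg hZ1 hZ.le)).add (hrefl.smul (div_nonneg hZ0.le hZ.le))
    have e1 : (fun σ : IndepState G => Z1 / Z * condGibbs lam (insert z A) (S.erase z) σ
        + Z0 / Z * condGibbs lam A (S.erase z) σ) = condGibbs lam A S := by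
      funext σ
      rw [condGibbs, condGibbs, condGibbs, ← hZ1def, ← hZ0def, ← hZdef,
        condWeight_split hzS hzA σ]
      field_simp
    have e2 : (fun σ : IndepState G => Z1 / Z * condGibbs lam A (S.erase z) σ
        + Z0 / Z * condGibbs lam A (S.erase z) σ) = condGibbs lam A (S.erase z) := by
      funext σ
      rw [← add_mul, hone, one_mul]
    rw [e1, e2, mul_zero, add_zero] at h1
    exact h1.mono (mul_le_mul_of_nonneg_right hp (by positivity))
  -- Here `z` has an occupied neighbour in `A`, so it is vacant anyway and the two distributions are
  -- equal.
  · have hw0 : ∀ σ : IndepState G, condWeight lam (insert z A) (S.erase z) σ = 0 := fun σ => by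
      rw [condWeight, if_neg]
      exact fun h => hA1 (σ.2.mono (by exact_mod_cast h.1))
    have hZ10 : Z1 = 0 := Finset.sum_eq_zero fun σ _ => hw0 σ
    have e : condGibbs (G := G) lam A S = condGibbs lam A (S.erase z) := by
      funext σ
      rw [condGibbs, condGibbs, ← hZ0def, ← hZdef, hZsplit, hZ10, zero_add,
        condWeight_split hzS hzA σ, hw0, zero_add]
    rw [e]
    exact hrefl.mono (by positivity)

end CondGibbs

/-! ## Contraction -/

section Contraction

variable {V : Type*} [Fintype V] {G : SimpleGraph V} [DecidableRel G.Adj]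
  {d α γ c lam ρ : ℝ}

/-! ### Weights of vertices and paths -/

theorem pathWeight_concat {u v z : V} (p : G.Walk u v) (h : G.Adj v z) :
    pathWeight d α γ c (p.concat h) = pathWeight d α γ c p * vertexWeight G d α γ c z := by
  simp [pathWeight, SimpleGraph.Walk.support_concat]

theorem vertexWeight_of_low {v : V} (h : (G.degree v : ℝ) ≤ (1 + α) * d) :
    vertexWeight G d α γ c v = (1 + γ)⁻¹ := if_pos h

theorem vertexWeight_of_high {v : V} (h : (1 + α) * d < (G.degree v : ℝ)) :
    vertexWeight G d α γ c v = d ^ c * (G.degree v : ℝ) := if_neg h.not_ge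

theorem degree_le_vertexWeight (hd : 1 < d) (hc : 0 ≤ c) {v : V}
    (h : (1 + α) * d < (G.degree v : ℝ)) : (G.degree v : ℝ) ≤ vertexWeight G d α γ c v := by
  rw [vertexWeight_of_high h]
  exact le_mul_of_one_le_left (Nat.cast_nonneg _) (Real.one_le_rpow hd.le hc)

theorem vertexWeight_pos (hd : 1 < d) (hα : 0 ≤ α) (hγ : 0 ≤ γ) (hc : 0 ≤ c) (v : V) :
    0 < vertexWeight G d α γ c v := by
  rcases le_or_gt (G.degree v : ℝ) ((1 + α) * d) with h | h
  · rw [vertexWeight_of_low h]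
    positivity
  · have : 0 ≤ (1 + α) * d := by positivity
    exact (this.trans_lt h).trans_le (degree_le_vertexWeight hd hc h)

theorem pathWeight_pos (hd : 1 < d) (hα : 0 ≤ α) (hγ : 0 ≤ γ) (hc : 0 ≤ c) {u v : V}
    (p : G.Walk u v) : 0 < pathWeight d α γ c p := by
  refine List.prod_pos fun x hx => ?_
  obtain ⟨y, -, rfl⟩ := List.mem_map.1 hx
  exact vertexWeight_pos hd hα hγ hc y

/-- The one-step contraction behind the choice of weights. At low degree `1 + γ` compensates the
weight `(1 + γ)⁻¹`; at high degree the weight already exceeds the degree. -/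
theorem mul_degree_le (hd : 1 < d) (hγ : 0 ≤ γ) (hc : 0 ≤ c) (hlam : 0 < lam)
    (h1 : lam * ((1 + α) * d) * (1 + γ) ≤ ρ) (h2 : lam ≤ ρ) (v : V) :
    lam * G.degree v ≤ ρ * vertexWeight G d α γ c v := by
  rcases le_or_gt (G.degree v : ℝ) ((1 + α) * d) with h | h
  · rw [vertexWeight_of_low h, ← div_eq_mul_inv, le_div_iff₀ (by positivity)]
    exact (mul_le_mul_of_nonneg_right (mul_le_mul_of_nonneg_left h hlam.le)
      (by positivity)).trans h1
  · exact mul_le_mul h2 (degree_le_vertexWeight hd hc h) (Nat.cast_nonneg _) (hlam.le.trans h2)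

/-! ### The blocks and their boundaries -/

theorem exists_mem_blocks (v : V) : ∃ B ∈ blocks G d α γ c, v ∈ B := by
  classical
  by_cases h : ∃ B ∈ cycleBlocks G d α γ c, v ∈ B
  · obtain ⟨B, hB, hv⟩ := h
    exact ⟨B, Finset.mem_union_left _ hB, hv⟩
  · push Not at h
    by_cases hb : IsBreakPoint G d α γ c v
    · exact ⟨{v}, Finset.mem_union_right _ (Finset.mem_filter.2
        ⟨Finset.mem_univ _, v, h, Or.inl ⟨hb, rfl⟩⟩), Finset.mem_singleton_self v⟩
    · refine ⟨Finset.univ.filter (InfluenceReachable G d α γ c v),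
        Finset.mem_union_right _ (Finset.mem_filter.2
          ⟨Finset.mem_univ _, v, h, Or.inr ⟨hb, by simp⟩⟩), ?_⟩
      refine Finset.mem_filter.2 ⟨Finset.mem_univ _, SimpleGraph.Walk.nil,
        SimpleGraph.Walk.IsPath.nil, ?_⟩
      simpa using hb

theorem nonempty_of_mem_blocks {B : Finset V} (hB : B ∈ blocks G d α γ c) : B.Nonempty := by
  classical
  rcases Finset.mem_union.1 hB with h | h
  · obtain ⟨-, v, C, -, -, h⟩ := Finset.mem_filter.1 h
    exact ⟨v, (h v).2 (Or.inl C.start_mem_support)⟩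
  · obtain ⟨-, v, -, ⟨-, rfl⟩ | ⟨hb, h⟩⟩ := Finset.mem_filter.1 h
    · exact Finset.singleton_nonempty v
    · refine ⟨v, (h v).2 ⟨SimpleGraph.Walk.nil, SimpleGraph.Walk.IsPath.nil, ?_⟩⟩
      simpa using hb

/-- A high degree vertex lies in the outer boundary of no block. -/
theorem InClassGB.not_inOuterBoundary {ε₀ : ℝ} (hd : 1 < d) (h0 : 0 < ε₀) (h1 : ε₀ ≤ 1 / 100)
    (hG : InClassGB G d ε₀) {w : V} (hw : (1 + ε₀ / 2) * d < (G.degree w : ℝ)) {B : Finset V}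
    (hB : B ∈ blocks G d (ε₀ / 2) (ε₀ ^ 2) 10) : ¬ InOuterBoundary G B w := by
  rintro ⟨hwB, z, hzB, hadj⟩
  obtain ⟨B', hB', hwB'⟩ := exists_mem_blocks (G := G) (d := d) (α := ε₀ / 2) (γ := ε₀ ^ 2)
    (c := 10) w
  -- Condition (B) is applied to the block of `w` itself: `z` lies on its outer boundary, and the
  -- single edge from `z` to `w` is too heavy.
  have hzB' : z ∉ B' := Finset.disjoint_left.1
    (hG.disjoint B hB B' hB' fun h => hwB (h ▸ hwB')) hzB
  refine hG.no_heavy_path B' hB' z ⟨hzB', w, hwB', hadj.symm⟩ w hwB' hw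
    ⟨SimpleGraph.Walk.cons hadj.symm SimpleGraph.Walk.nil, by simp [hadj.ne'], ?_⟩
  -- Since `ε₀ / 2 ≥ ε₀ ^ 2`, this outweighs the least possible weight `(1 + ε₀ ^ 2)⁻¹` of `z`.
  have hW : 1 + ε₀ / 2 < vertexWeight G d (ε₀ / 2) (ε₀ ^ 2) 10 w := by
    refine lt_of_lt_of_le ?_ (degree_le_vertexWeight hd (by norm_num) hw)
    nlinarith
  have hz : (1 + ε₀ ^ 2)⁻¹ ≤ vertexWeight G d (ε₀ / 2) (ε₀ ^ 2) 10 z := by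
    rcases le_or_gt (G.degree z : ℝ) ((1 + ε₀ / 2) * d) with h | h
    · exact (vertexWeight_of_low h).ge
    · refine le_trans (inv_le_one_of_one_le₀ (by nlinarith)) ?_
      refine le_trans ?_ (degree_le_vertexWeight hd (by norm_num) h)
      nlinarith
  simp only [pathWeight, SimpleGraph.Walk.support_cons, SimpleGraph.Walk.support_nil,
    List.map_cons, List.map_nil, List.prod_cons, List.prod_nil, mul_one]
  calc (1 : ℝ) = (1 + ε₀ ^ 2)⁻¹ * (1 + ε₀ ^ 2) := (inv_mul_cancel₀ (by positivity)).symm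
    _ < (1 + ε₀ ^ 2)⁻¹ * vertexWeight G d (ε₀ / 2) (ε₀ ^ 2) 10 w :=
        mul_lt_mul_of_pos_left (by nlinarith) (by positivity)
    _ ≤ _ := mul_le_mul_of_nonneg_right hz (by linarith)

/-! ### Propagation of a disagreement inside a block -/

variable [DecidableEq V]

/-- If no path from `w` to a high degree vertex of `B` is heavy, then a disagreement which has
travelled from `w` along a path of weight `x` has expected size at most `lam / ((1 - ρ) x)`. -/
theorem transport_condGibbs_erase_of_path (hd : 1 < d) (hα : 0 ≤ α) (hγ : 0 ≤ γ) (hc : 0 ≤ c)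
    (hlam : 0 < lam) (h1 : lam * ((1 + α) * d) * (1 + γ) ≤ ρ) (h2 : lam ≤ ρ) (hρ : ρ < 1)
    {A B : Finset V} {w : V} (hA : G.IsIndepSet (A : Set V)) (hAB : Disjoint A B)
    (hB : ∀ z ∈ B, (1 + α) * d < (G.degree z : ℝ) → ∀ L : G.Walk w z, L.IsPath →
      pathWeight d α γ c L ≤ 1)
    (S : Finset V) (hS : S ⊆ B) {y z : V} (Q : G.Walk w y) (hQ : Q.IsPath)
    (hQS : ∀ x ∈ Q.support, x ∉ S) (hQ1 : pathWeight d α γ c Q ≤ 1) (hz : z ∈ S)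
    (hyz : G.Adj y z) :
    TransportLE (hammingCost (G := G)) (condGibbs lam A S) (condGibbs lam A (S.erase z))
      (lam * (1 - ρ)⁻¹ / pathWeight d α γ c Q) := by
  -- The available set shrinks at each step. The invariant that `Q` avoids `S` keeps the extended
  -- walk a path.
  induction S using Finset.strongInduction generalizing y z with
  | H S ih =>
    have hρ' : 0 < 1 - ρ := sub_pos.2 hρ
    have ha := pathWeight_pos hd hα hγ hc Q
    have hW := vertexWeight_pos (G := G) hd hα hγ hc z
    have hpath : (Q.concat hyz).IsPath := hQ.concat (fun h => hQS z h hz) hyz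
    -- A low degree `z` multiplies the weight by at most 1. A high degree `z` may raise it, but then
    -- the whole path is bounded by `hB`.
    have hle : pathWeight d α γ c (Q.concat hyz) ≤ 1 := by
      rcases le_or_gt (G.degree z : ℝ) ((1 + α) * d) with h | h
      · rw [pathWeight_concat, vertexWeight_of_low h]
        exact mul_le_one₀ hQ1 (by positivity) (inv_le_one_of_one_le₀ (by linarith))
      · exact hB z (hS hz) h _ hpath
    have hdeg := mul_degree_le (G := G) (c := c) hd hγ hc hlam h1 h2 z
    have hcard : (((S.erase z).filter (G.Adj z)).card : ℝ) ≤ G.degree z := by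
      rw [← SimpleGraph.card_neighborFinset_eq_degree]
      exact_mod_cast Finset.card_le_card fun x hx => by
        simpa using (Finset.mem_filter.1 hx).2
    refine (transport_condGibbs_erase hlam hA
      (fun h => Finset.disjoint_left.1 hAB h (hS hz)) hz
      (t := lam * (1 - ρ)⁻¹ / pathWeight d α γ c (Q.concat hyz))
      (div_nonneg (by positivity) (pathWeight_pos hd hα hγ hc _).le) ?_).mono ?_
    · intro x _ hzx T hT hxT
      have hTS : T ⊂ S := hT.trans_ssubset (Finset.erase_ssubset hz)
      refine ih T hTS (hTS.subset.trans hS) (Q.concat hyz) hpath (fun v hv hvT => ?_) hle hxT hzx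
      rw [SimpleGraph.Walk.support_concat] at hv
      simp only [List.mem_append, List.mem_singleton] at hv
      rcases hv with hv | rfl
      · exact hQS v hv (hTS.subset hvT)
      · exact Finset.notMem_erase v S (hT hvT)
    · rw [pathWeight_concat]
      set a := pathWeight d α γ c Q
      set W := vertexWeight G d α γ c z
      have h3 : (((S.erase z).filter (G.Adj z)).card : ℝ) * (lam * (1 - ρ)⁻¹ / (a * W))
          ≤ ρ * ((1 - ρ)⁻¹ / a) := by
        calc _ ≤ (G.degree z : ℝ) * (lam * (1 - ρ)⁻¹ / (a * W)) :=
              mul_le_mul_of_nonneg_right hcard (by positivity)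
          _ = lam * G.degree z * ((1 - ρ)⁻¹ / (a * W)) := by ring
          _ ≤ ρ * W * ((1 - ρ)⁻¹ / (a * W)) :=
              mul_le_mul_of_nonneg_right hdeg (by positivity)
          _ = ρ * ((1 - ρ)⁻¹ / a) := by field_simp
      -- This is `1 ≤ 1 / a`: the unit cost of `z` itself is absorbed because the path weight `a` is
      -- at most 1. With `h3`, the geometric recursion closes.
      have h4 : 1 ≤ (1 - ρ) * ((1 - ρ)⁻¹ / a) := by
        rw [mul_div_assoc', mul_inv_cancel₀ hρ'.ne']
        exact (one_le_div ha).2 hQ1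
      rw [mul_div_assoc lam (1 - ρ)⁻¹ a]
      refine mul_le_mul_of_nonneg_left ?_ hlam.le
      linarith

/-! ### Averaging over the blocks -/

theorem card_le_of_pairwiseDisjoint {𝓑 : Finset (Finset V)}
    (hdisj : ∀ B₁ ∈ 𝓑, ∀ B₂ ∈ 𝓑, B₁ ≠ B₂ → Disjoint B₁ B₂) (hne : ∀ B ∈ 𝓑, B.Nonempty) :
    𝓑.card ≤ Fintype.card V := by
  calc 𝓑.card = ∑ B ∈ 𝓑, 1 := by simp
    _ ≤ ∑ B ∈ 𝓑, B.card := Finset.sum_le_sum fun B hB => (hne B hB).card_pos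
    _ = (𝓑.biUnion id).card := (Finset.card_biUnion hdisj).symm
    _ ≤ Fintype.card V := Finset.card_le_univ _

theorem sum_card_filter_adj_le {𝓑 : Finset (Finset V)}
    (hdisj : ∀ B₁ ∈ 𝓑, ∀ B₂ ∈ 𝓑, B₁ ≠ B₂ → Disjoint B₁ B₂) (w : V) :
    ∑ B ∈ 𝓑, (B.filter (G.Adj w)).card ≤ G.degree w := by
  rw [← Finset.card_biUnion fun B₁ h₁ B₂ h₂ h =>
    Finset.disjoint_filter_filter (hdisj B₁ h₁ B₂ h₂ h),
    ← SimpleGraph.card_neighborFinset_eq_degree]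
  refine Finset.card_le_card fun x hx => ?_
  obtain ⟨B, -, hx⟩ := Finset.mem_biUnion.1 hx
  simpa using (Finset.mem_filter.1 hx).2

/-- The cost of the update of a block which does not contain the disagreement. -/
theorem transport_blockUpdate {ε₀ : ℝ} (hd : 1 < d) (h0 : 0 < ε₀) (hε : ε₀ ≤ 1 / 100)
    (hlam : 0 < lam) (h1 : lam * ((1 + ε₀ / 2) * d) * (1 + ε₀ ^ 2) ≤ ρ) (h2 : lam ≤ ρ)
    (hρ : ρ < 1) (hG : InClassGB G d ε₀) {X Y : IndepState G} {w : V} (hwY : w ∉ Y.1)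
    (hX : X.1 = insert w Y.1) {B : Finset V} (hB : B ∈ blocks G d (ε₀ / 2) (ε₀ ^ 2) 10)
    (hwB : w ∉ B) :
    TransportLE (hammingCost (G := G)) (blockUpdate lam B X) (blockUpdate lam B Y)
      (1 + (B.filter (G.Adj w)).card * (lam * (1 - ρ)⁻¹ * (1 + ε₀ ^ 2))) := by
  have hXB : X.1 \ B = insert w (Y.1 \ B) := by
    rw [hX, Finset.insert_sdiff_of_notMem _ hwB]
  have hγ : (0 : ℝ) ≤ ε₀ ^ 2 := by positivity
  rw [blockUpdate_eq_condGibbs hlam, blockUpdate_eq_condGibbs hlam, hXB]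
  refine transport_condGibbs_insert hlam (hXB ▸ X.2.mono (by simp)) (by simp [hwY]) hwB ?_
  intro z hzB hwz T hT hzT
  have hbd : InOuterBoundary G B w := ⟨hwB, z, hzB, hwz⟩
  have hlow : (G.degree w : ℝ) ≤ (1 + ε₀ / 2) * d :=
    -- As `w` has low degree, the trivial path at `w` has weight `(1 + ε₀ ^ 2)⁻¹ ≤ 1` and can start
    -- the induction.
    not_lt.1 fun h => hG.not_inOuterBoundary hd h0 hε h hB hbd
  have hnil : pathWeight d (ε₀ / 2) (ε₀ ^ 2) 10 (SimpleGraph.Walk.nil : G.Walk w w)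
      = (1 + ε₀ ^ 2)⁻¹ := by
    simp [pathWeight, vertexWeight_of_low hlow]
  have := transport_condGibbs_erase_of_path hd (α := ε₀ / 2) (γ := ε₀ ^ 2) (c := 10)
    (by positivity) hγ (by norm_num) hlam h1 h2 hρ (A := Y.1 \ B) (Y.2.mono (by simp))
    Finset.sdiff_disjoint
    (fun u hu hdeg L hL => not_lt.1 fun h => hG.no_heavy_path B hB w hbd u hu hdeg ⟨L, hL, h⟩)
    T hT (SimpleGraph.Walk.nil : G.Walk w w) SimpleGraph.Walk.IsPath.nil
    (fun x hx hxT => hwB (hT (by simpa using (by simpa using hx : x = w) ▸ hxT)))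
    (hnil ▸ inv_le_one_of_one_le₀ (by linarith)) hzT hwz
  rwa [hnil, div_inv_eq_mul] at this

theorem transport_blockStep {ε₀ : ℝ} (hd : 1 < d) (h0 : 0 < ε₀) (hε : ε₀ ≤ 1 / 100)
    (hlam : 0 < lam) (hlam' : lam ≤ (1 - ε₀) / (2 * d)) (hG : InClassGB G d ε₀)
    {X Y : IndepState G} {w : V} (hwY : w ∉ Y.1) (hX : X.1 = insert w Y.1) :
    TransportLE (hammingCost (G := G))
      (blockStep lam (blocks G d (ε₀ / 2) (ε₀ ^ 2) 10) X)
      (blockStep lam (blocks G d (ε₀ / 2) (ε₀ ^ 2) 10) Y)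
      (1 - (ε₀ - 20 * ε₀ ^ 2) / (Fintype.card V : ℝ)) := by
  have hdisj := hG.disjoint
  have hblock := fun B (hB : B ∈ blocks G d (ε₀ / 2) (ε₀ ^ 2) 10) =>
    nonempty_of_mem_blocks hB
  -- This is `lam * (1 + α) * d * (1 + γ)` at the largest admissible fugacity `lam = (1 - ε₀) / (2 *
  -- d)`.
  obtain ⟨ρ, hρdef⟩ : ∃ ρ, ρ = (1 - ε₀) / 2 * (1 + ε₀ / 2) * (1 + ε₀ ^ 2) := ⟨_, rfl⟩
  have hld : lam * d ≤ (1 - ε₀) / 2 := by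
    rw [le_div_iff₀ (by positivity)] at hlam'
    linarith
  have h1 : lam * ((1 + ε₀ / 2) * d) * (1 + ε₀ ^ 2) ≤ ρ := by
    rw [hρdef]
    calc _ = lam * d * ((1 + ε₀ / 2) * (1 + ε₀ ^ 2)) := by ring
      _ ≤ (1 - ε₀) / 2 * ((1 + ε₀ / 2) * (1 + ε₀ ^ 2)) :=
          mul_le_mul_of_nonneg_right hld (by positivity)
      _ = _ := by ring
  have h2ρ : 2 * ρ ≤ 1 - ε₀ / 2 + ε₀ ^ 2 / 2 := by
    have h3 : 0 ≤ ε₀ ^ 3 := by positivity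
    have h4 : 0 ≤ ε₀ ^ 4 := by positivity
    rw [hρdef]
    nlinarith
  have hρ : ρ < 1 := by nlinarith
  have h2 : lam ≤ ρ := by
    refine le_trans ?_ h1
    have : 1 ≤ (1 + ε₀ / 2) * d * (1 + ε₀ ^ 2) := by
      refine one_le_mul_of_one_le_of_one_le (one_le_mul_of_one_le_of_one_le ?_ hd.le) ?_
      · linarith
      · nlinarith
    rw [mul_assoc]
    exact le_mul_of_one_le_right hlam.le this
  -- To first order `ρ` is `1/2 - ε₀/4`, so the ratio is about `1 - ε₀`. The term `20 * ε₀ ^ 2`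
  -- absorbs the higher orders.
  have hgap : ρ * (1 - ρ)⁻¹ ≤ 1 - (ε₀ - 20 * ε₀ ^ 2) := by
    rw [← div_eq_mul_inv, div_le_iff₀ (by linarith)]
    have h3 : 0 ≤ ε₀ ^ 3 := by positivity
    have h4 : ε₀ ^ 4 ≤ ε₀ ^ 2 := by
      nlinarith [sq_nonneg ε₀, mul_nonneg (sq_nonneg ε₀) (by nlinarith : 0 ≤ 1 - ε₀ ^ 2)]
    have h5 : 2 * ρ * (1 - (ε₀ - 20 * ε₀ ^ 2) / 2)
        ≤ (1 - ε₀ / 2 + ε₀ ^ 2 / 2) * (1 - (ε₀ - 20 * ε₀ ^ 2) / 2) :=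
      mul_le_mul_of_nonneg_right h2ρ (by nlinarith)
    nlinarith
  set τ : ℝ := lam * (1 - ρ)⁻¹ * (1 + ε₀ ^ 2) with hτ
  have hτ0 : 0 ≤ τ := by
    have : 0 < 1 - ρ := by linarith
    positivity
  obtain ⟨B₀, hB₀, hwB₀⟩ := exists_mem_blocks (G := G) (d := d) (α := ε₀ / 2) (γ := ε₀ ^ 2)
    (c := 10) w
  have hstep := fun B (hB : B ∈ blocks G d (ε₀ / 2) (ε₀ ^ 2) 10) (hwB : w ∉ B) =>
    transport_blockUpdate hd h0 hε hlam h1 h2 hρ hG hwY hX hB hwB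
  have hhigh := fun B (hB : B ∈ blocks G d (ε₀ / 2) (ε₀ ^ 2) 10) hw =>
    hG.not_inOuterBoundary (w := w) hd h0 hε hw hB
  set 𝓑 := blocks G d (ε₀ / 2) (ε₀ ^ 2) 10
  have hsame : ∀ B, w ∈ B → blockUpdate lam B X = blockUpdate lam B Y := fun B hwB => by
    rw [blockUpdate_eq_condGibbs hlam, blockUpdate_eq_condGibbs hlam, hX,
      Finset.insert_sdiff_of_mem _ hwB]
  have hN : (0 : ℝ) < 𝓑.card := by exact_mod_cast Finset.card_pos.2 ⟨B₀, hB₀⟩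
  have hNn : (𝓑.card : ℝ) ≤ Fintype.card V := by
    exact_mod_cast card_le_of_pairwiseDisjoint hdisj hblock
  have key := TransportLE.sum (c := hammingCost (G := G)) 𝓑
    (P := fun B σ => 1 / (𝓑.card : ℝ) * blockUpdate lam B X σ)
    (Q := fun B σ => 1 / (𝓑.card : ℝ) * blockUpdate lam B Y σ)
    (t := fun B => 1 / (𝓑.card : ℝ) *
      (if w ∈ B then 0 else 1 + (B.filter (G.Adj w)).card * τ)) fun B hB => by
    refine TransportLE.smul (by positivity) ?_
    split_ifs with hwB
    · rw [hsame B hwB, blockUpdate_eq_condGibbs hlam]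
      exact TransportLE.refl (by simp [hammingCost, hamming_self]) (condGibbs_nonneg hlam _ _)
    · exact hstep B hB hwB
  refine TransportLE.mono key ?_
  have hnbr : ∑ B ∈ 𝓑, (if w ∈ B then 0 else ((B.filter (G.Adj w)).card : ℝ) * τ)
      ≤ ρ * (1 - ρ)⁻¹ := by
    rcases le_or_gt (G.degree w : ℝ) ((1 + ε₀ / 2) * d) with hw | hw
    · calc _ ≤ ∑ B ∈ 𝓑, ((B.filter (G.Adj w)).card : ℝ) * τ := by
            refine Finset.sum_le_sum fun B _ => ?_
            split_ifs
            exacts [by positivity, le_rfl]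
        _ ≤ (1 + ε₀ / 2) * d * τ := by
            rw [← Finset.sum_mul]
            refine mul_le_mul_of_nonneg_right (le_trans ?_ hw) hτ0
            exact_mod_cast sum_card_filter_adj_le hdisj w
        _ = lam * ((1 + ε₀ / 2) * d) * (1 + ε₀ ^ 2) * (1 - ρ)⁻¹ := by rw [hτ]; ring
        _ ≤ _ := mul_le_mul_of_nonneg_right h1 (inv_nonneg.2 (by linarith))
    -- A high degree `w` has no neighbour in any other block, so nothing propagates.
    · rw [Finset.sum_eq_zero]
      · exact mul_nonneg (hlam.le.trans h2) (inv_nonneg.2 (by linarith))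
      · intro B hB
        split_ifs with hwB
        · rfl
        · rw [Finset.filter_eq_empty_iff.2 fun z hz hadj => hhigh B hB hw ⟨hwB, z, hz, hadj⟩]
          simp
  -- The block `B₀` of `w` removes the disagreement; this saves 1, against a total propagation of at
  -- most `1 - (ε₀ - 20 * ε₀ ^ 2)`.
  have hone : ∑ B ∈ 𝓑, (if w ∈ B then (0 : ℝ) else 1) ≤ 𝓑.card - 1 := by
    rw [← Finset.add_sum_erase _ _ hB₀, if_pos hwB₀, zero_add]
    calc _ ≤ ∑ B ∈ 𝓑.erase B₀, (1 : ℝ) := Finset.sum_le_sum fun B _ => by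
          split_ifs
          exacts [zero_le_one, le_rfl]
      _ = 𝓑.card - 1 := by
          rw [Finset.sum_const, nsmul_eq_mul, mul_one, Finset.cast_card_erase_of_mem hB₀]
  have hsum : ∑ B ∈ 𝓑, (if w ∈ B then 0 else 1 + ((B.filter (G.Adj w)).card : ℝ) * τ)
      ≤ 𝓑.card - (ε₀ - 20 * ε₀ ^ 2) := by
    calc _ = ∑ B ∈ 𝓑, (if w ∈ B then (0 : ℝ) else 1)
          + ∑ B ∈ 𝓑, (if w ∈ B then 0 else ((B.filter (G.Adj w)).card : ℝ) * τ) := by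
          rw [← Finset.sum_add_distrib]
          refine Finset.sum_congr rfl fun B _ => ?_
          split_ifs <;> simp
      _ ≤ _ := by linarith
  rw [← Finset.mul_sum]
  calc _ ≤ 1 / (𝓑.card : ℝ) * (𝓑.card - (ε₀ - 20 * ε₀ ^ 2)) :=
        mul_le_mul_of_nonneg_left hsum (by positivity)
    _ = 1 - (ε₀ - 20 * ε₀ ^ 2) / 𝓑.card := by field_simp
    -- Passing from the number of blocks to `n` needs `ε₀ - 20 * ε₀ ^ 2 ≥ 0`, which follows from `ε₀
    -- ≤ 1 / 100`.
    _ ≤ _ := sub_le_sub_left (div_le_div_of_nonneg_left (by nlinarith) hN hNn) _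

end Contraction

theorem theorem6 {V : Type*} [Fintype V] [DecidableEq V] (G : SimpleGraph V) [DecidableRel G.Adj]
    (ε d lam ε₀ : ℝ) (hε : 0 < ε) (hε₀ : ε₀ = min ε (1 / 100)) (hd : 1 < d)
    (hlam : 0 < lam) (hlam' : lam ≤ (1 - ε) / (2 * d))
    (hG : InClassGB G d ε₀)
    (X Y : IndepState G) (hXY : hamming X Y = 1) :
    ∃ ν : IndepState G → IndepState G → ℝ,
      IsCoupling (blockStep lam (blocks G d (ε₀ / 2) (ε₀ ^ 2) 10) X)
        (blockStep lam (blocks G d (ε₀ / 2) (ε₀ ^ 2) 10) Y) ν ∧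
      ∑ X', ∑ Y', ν X' Y' * (hamming X' Y' : ℝ)
        ≤ 1 - (ε₀ - 20 * ε₀ ^ 2) / (Fintype.card V : ℝ) := by
  have h0 : 0 < ε₀ := by
    rw [hε₀]
    exact lt_min hε (by norm_num)
  have h1 : ε₀ ≤ 1 / 100 := hε₀ ▸ min_le_right _ _
  have hlam₀ : lam ≤ (1 - ε₀) / (2 * d) :=
    hlam'.trans (div_le_div_of_nonneg_right (by linarith [hε₀ ▸ min_le_left ε (1 / 100)])
      (by positivity))
  obtain ⟨w, hw⟩ := Finset.card_eq_one.1 hXY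
  have hmem : ∀ v, (v ∈ X.1 ∧ v ∉ Y.1 ∨ v ∈ Y.1 ∧ v ∉ X.1) ↔ v = w := fun v => by
    rw [← Finset.mem_symmDiff, hw, Finset.mem_singleton]
  suffices h : TransportLE (hammingCost (G := G))
      (blockStep lam (blocks G d (ε₀ / 2) (ε₀ ^ 2) 10) X)
      (blockStep lam (blocks G d (ε₀ / 2) (ε₀ ^ 2) 10) Y)
      (1 - (ε₀ - 20 * ε₀ ^ 2) / (Fintype.card V : ℝ)) from h
  rcases (hmem w).2 rfl with ⟨hX, hY⟩ | ⟨hY, hX⟩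
  · refine transport_blockStep hd h0 h1 hlam hlam₀ hG hY ?_
    ext v
    have := hmem v
    by_cases hv : v = w
    · simp [hv, hX]
    · simp only [hv, iff_false] at this
      simp only [Finset.mem_insert, hv, false_or]
      tauto
  -- The disagreeing vertex is occupied in `Y`, so the roles are exchanged and the coupling is
  -- transposed.
  · refine (transport_blockStep hd h0 h1 hlam hlam₀ hG hX ?_).symm fun σ τ => by
      rw [hammingCost, hammingCost, hamming_comm]
    ext v
    have := hmem v
    by_cases hv : v = w
    · simp [hv, hY]
    · simp only [hv, iff_false] at this
      simp only [Finset.mem_insert, hv, false_or]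
      tauto
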